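/- For integers $i,j\ge 0$ and real $\kappa$ let $b_{i,j,\kappa}=\sum_{r=0}^{j}\binom{j}{r}(-1)^{j-r}(r+\kappa)^i$ (with $0^0=1$ throughout). Let $(X_n)_{n\ge 0}$ be a time-homogeneous discrete-time Markov chain on a finite set $S$ with transition matrix $P=(p_{ij})$, let $M\subset S$ with $M\ne\emptyset$ and $\overline M=S\setminus M\neq\emptyset$, and write $P_M$, $P_{M\overline M}$, $P_{\overline M M}$, $P_{\overline M}$ for the blocks of $P$ (e.g. $P_{M\overline M}=(p_{ij})_{i\in M,\,j\in\overline M}$). Assume that $I-P_M$ is invertible. For $k\ge 1$ and $n\ge 0$ let $P(\mathcal N_k=n)$ be the $|M|\times|\overline M|$ matrix whose $(i,j)$ entry is the probability, starting in $X_0=i\in M$, that $n$ is the first time at which the number of visits to $\overline M$ equals $k$ and that $X_n=j$. Put $M_m(\mathcal N_k)=\sum_{n=0}^{\infty}n^m\,P(\mathcal N_k=n)$. Call $P$ $M$-commutable if $P_{M\overline M}P_{\overline M}^{s}P_{\overline M M}P_M^{r}=P_M^{r}P_{M\overline M}P_{\overline M}^{s}P_{\overline M M}$ for all integers $r,s\ge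 0$; $\overline M$-commutability is defined in the same way with $M$ and $\overline M$ exchanged. Let $e_M$ be the all-ones column vector indexed by $M$. **Theorem.** Let $m\ge 0$ and $k\ge 1$ be integers. In each of the following cases the series $M_m(\mathcal N_k)$ converges, with the stated value. a) If $P$ is $M$-commutable and $\overline M$-commutable and $Q=P_{\overline M M}P_{M\overline M}$, then $$M_m(\mathcal N_k)=\sum_{r=0}^{k-1}\binom{k-1}{r}\sum_{j=0}^{m}b_{m,j,k+r}\binom{j+r}{j}P_M^{j}(I-P_M)^{-(j+r+1)}P_{M\overline M}P_{\overline M}^{k-1-r}Q^{r}.$$ b) (Phase-type case.) If $|\overline M|=1$ with $P_{\overline M}=(q)$ and $P_M e_M=s_M e_M$, then $$M_m(\mathcal N_k)=\sum_{r=0}^{k-1}\binom{k-1}{r}\Big(\frac{1-q}{q}\Big)^{r}q^{k-1}\sum_{j=0}^{m}b_{m,j,k+r}\binom{j+r}{j}\Big(\frac{s_M}{1-s_M}\Big)^{j}e_M,$$ where for $q=0$ the factor $\big(\frac{1-q}{q}\big)^{r}q^{k-1}$ is read as $(1-q)^{r}q^{k-1-r}$. c) (Alternating negative binomial case.) If $|\overline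 M|=|M|=1$ with $P_{\overline M}=(q)$ and $P_M=(1-p)$, then, with the same convention for $q=0$, $$M_m(\mathcal N_k)=\sum_{r=0}^{k-1}\binom{k-1}{r}\Big(\frac{1-q}{q}\Big)^{r}q^{k-1}\sum_{j=0}^{m}b_{m,j,k+r}\binom{j+r}{j}\Big(\frac{1-p}{p}\Big)^{j}.$$ d) If in c) $p=q$, then $\mathcal N_k$ has the ordinary negative binomial distribution, $P(\mathcal N_k=n)=\binom{n-1}{k-1}p^k(1-p)^{n-k}$ for $n\ge k$ and $P(\mathcal N_k=n)=0$ for $n<k$, and $$M_m(\mathcal N_k)=\sum_{j=0}^{m}\binom{j+k-1}{k-1}b_{m,j,k}\Big(\frac{1-p}{p}\Big)^{j}.$$ -/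

import Mathlib

open MeasureTheory Finset

noncomputable section

/-- The moment generating Stirling numbers (of the second kind) `b_{i,j,k}`. -/
def msn (i j : ℕ) (k : ℝ) : ℝ :=
  ∑ r ∈ range (j + 1), (j.choose r : ℝ) * (-1) ^ (j - r) * ((r : ℝ) + k) ^ i

/-- The canonical Markov family `(ℙ_i)_{i ∈ S}` of a time-homogeneous discrete time Markov chain
`X` with finite state space `S` and transition matrix `P`: under `ℙ i` the process `X` starts in
`i` and is a Markov chain with one-step transition probabilities `P`. -/
structure IsMarkovFamily {S Ω : Type*} [MeasurableSpace S] [MeasurableSpace Ω]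
    (P : Matrix S S ℝ) (ℙ : S → Measure Ω) (X : ℕ → Ω → S) : Prop where
  isProbability : ∀ i, IsProbabilityMeasure (ℙ i)
  measurable : ∀ n, Measurable (X n)
  start : ∀ i, ∀ᵐ ω ∂(ℙ i), X 0 ω = i
  markov : ∀ (i : S) (n : ℕ) (x : ℕ → S),
    (ℙ i).real {ω | ∀ t ≤ n + 1, X t ω = x t}
      = (ℙ i).real {ω | ∀ t ≤ n, X t ω = x t} * P (x n) (x (n + 1))

/-- Number of visits of `X` in the set of states `T` up to (and including) time `r`. -/
def visits {S Ω : Type*} [DecidableEq S] (X : ℕ → Ω → S) (T : Finset S) (r : ℕ) (ω : Ω) : ℕ :=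
  #{t ∈ range (r + 1) | X t ω ∈ T}

/-- The first time `r` at which the number of visits in `T` equals `k` (`⊤` if there is none). -/
def passageTime {S Ω : Type*} [DecidableEq S] (X : ℕ → Ω → S) (T : Finset S) (k : ℕ) (ω : Ω) :
    ℕ∞ :=
  ⨅ (r : ℕ) (_ : visits X T r ω = k), (r : ℕ∞)

/-- The `|M| × |M̄|` matrix `P(𝒩_k = n)`: its `(i, j)` entry is the probability, starting in
`i ∈ M`, that the `k`-th passage time into `M̄` is `n` and that the chain is then in `j ∈ M̄`. -/
def passageProb {S Ω : Type*} [Fintype S] [DecidableEq S] [MeasurableSpace Ω]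
    (ℙ : S → Measure Ω) (X : ℕ → Ω → S) (M : Finset S) (k n : ℕ) :
    Matrix M (Mᶜ : Finset S) ℝ :=
  Matrix.of fun i j => (ℙ i).real {ω | passageTime X Mᶜ k ω = n ∧ X n ω = j}

/-- `M_m(𝒩_k) = ∑_{n ≥ 0} n ^ m • P(𝒩_k = n)` exists and equals `A`. -/
def HasPassageMoment {S Ω : Type*} [Fintype S] [DecidableEq S] [MeasurableSpace Ω]
    (ℙ : S → Measure Ω) (X : ℕ → Ω → S) (M : Finset S) (k m : ℕ)
    (A : Matrix M (Mᶜ : Finset S) ℝ) : Prop :=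
  HasSum (fun n : ℕ => (n : ℝ) ^ m • passageProb ℙ X M k n) A

/-- The block `P_{AB} = (p_{ij})_{i ∈ A, j ∈ B}` of `P`. -/
def block {S : Type*} (P : Matrix S S ℝ) (A B : Finset S) : Matrix A B ℝ :=
  Matrix.of fun i j => P i j

/-- `A`-commutability of `P`, where `B` is the complement of `A`:
`P_{AB} P_B^s P_{BA} P_A^r = P_A^r P_{AB} P_B^s P_{BA}` for all `r, s ≥ 0`. -/
def IsCommutable {S : Type*} [DecidableEq S] (P : Matrix S S ℝ) (A B : Finset S) : Prop :=
  ∀ r s : ℕ,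
    block P A B * block P B B ^ s * block P B A * block P A A ^ r
      = block P A A ^ r * block P A B * block P B B ^ s * block P B A

/-- The probability that the `k`-th success in independent Bernoulli trials with success
probability `p` occurs at trial `n`. -/
def negBinomial (p : ℝ) (k n : ℕ) : ℝ :=
  if k ≤ n then ((n - 1).choose (k - 1) : ℝ) * p ^ k * (1 - p) ^ (n - k) else 0

end

/-!
Write the transition matrix in blocks `A = P_M`, `B = P_{M M̄}`, `C = P_{M̄}`, `D = P_{M̄ M}`. Let
`a k n` and `c k n` be the matrices of probabilities that the chain, started in `M`, has made `k`
visits to `M̄` up to time `n` and is then in `M`, respectively in `M̄`. As a visit increases the count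
exactly when it occurs, `c k n` is `P(𝒩_k = n)` (`passageTime_eq_iff`,
`passageProb_eq_visitBlock`), and the Markov property gives the recursion

* `a k (n + 1) = a k n * A + c k n * D`,
* `c (k + 1) (n + 1) = a k n * B + c k n * C`

with `a 0 n = A ^ n` (`visitBlock_succ_left`, `visitBlock_succ_right`).

The recursion can be solved explicitly when powers of `A` may be pulled to the left through
`B * C ^ s * D`, and `C` commutes with `Q = D * B`. The first property is needed only after
multiplication by `B` on the right. By Pascal's rule the solution is
`P(𝒩_{k+1} = k + 1 + l) = ∑ r, (k choose r) (l choose r) A ^ (l - r) B C ^ (k - r) Q ^ r`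
(`block_recursion_right`, `passageProb_succ_add`). Commutability implies both properties. So does
the phase-type hypothesis, for which `M`-commutability itself may fail: the all-ones matrix is then
an eigenvector of `A` and `B` is a multiple of it (`IsPhaseType`).

For the moments, the numbers `msn m j κ` are the forward differences of `x ↦ (x + κ) ^ m` at `0`, so
that `(l + κ) ^ m = ∑ j, (l choose j) * msn m j κ` (`add_pow_eq_sum_choose_mul_msn`). Together with
`∑ l, (l + r choose r) A ^ l = (1 - A)⁻¹ ^ (r + 1)` this sums the moment series for each `r`
(`hasSum_add_pow_mul_choose_smul_pow`). Convergence is not a matter of norms, since `A` may have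
norm `1`: the partial sums of `∑ A ^ n` are `(1 - A ^ N) (1 - A)⁻¹`, and `A` is substochastic, so
they are nonnegative and bounded (`hasSum_pow_of_substochastic`).

If in addition every step enters `M̄` with the same probability `p`, from either side, every term
of the distribution carries the same power of `p` and `1 - p`, and Vandermonde's identity
collapses the sum over `r` to the negative binomial distribution
(`IsPhaseType.passageProb_eq_negBinomial`).
-/

/-! ### Moment generating Stirling numbers and moments of geometric series -/

/-- The numbers `msn m j κ` are the forward differences at `0` of `x ↦ (x + κ) ^ m`. -/
theorem msn_eq_fwdDiff (m j : ℕ) (κ : ℝ) :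
    msn m j κ = (fwdDiff (1 : ℝ))^[j] (fun x : ℝ => (x + κ) ^ m) 0 := by
  rw [fwdDiff_iter_eq_sum_shift, msn]
  refine sum_congr rfl fun r _ => ?_
  simp only [zsmul_eq_mul, nsmul_eq_mul]
  push_cast
  ring_nf

theorem msn_eq_zero_of_lt {m j : ℕ} (h : m < j) (κ : ℝ) : msn m j κ = 0 := by
  rw [msn_eq_fwdDiff, fwdDiff_iter_comp_add (1 : ℝ) (fun x : ℝ => x ^ m) κ j 0,
    fwdDiff_iter_pow_eq_zero_of_lt h]
  rfl

/-- Newton's forward difference expansion of `(l + κ) ^ m` in the binomial basis. -/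
theorem add_pow_eq_sum_choose_mul_msn (m l : ℕ) (κ : ℝ) :
    ((l : ℝ) + κ) ^ m = ∑ j ∈ range (m + 1), (l.choose j : ℝ) * msn m j κ := by
  have h := shift_eq_sum_fwdDiff_iter (1 : ℝ) (fun x : ℝ => (x + κ) ^ m) l 0
  simp only [zero_add, nsmul_eq_mul, mul_one, ← msn_eq_fwdDiff] at h
  rw [h]
  -- both sums may be extended to a common range: beyond `l` the binomial coefficient vanishes,
  -- beyond `m` the forward difference does
  have h1 : ∑ j ∈ range (l + 1), (l.choose j : ℝ) * msn m j κ
      = ∑ j ∈ range (l + m + 1), (l.choose j : ℝ) * msn m j κ := by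
    refine sum_subset (range_subset_range.2 (by omega)) fun j _ hj => ?_
    rw [Nat.choose_eq_zero_of_lt (by simp at hj; omega)]
    simp
  have h2 : ∑ j ∈ range (m + 1), (l.choose j : ℝ) * msn m j κ
      = ∑ j ∈ range (l + m + 1), (l.choose j : ℝ) * msn m j κ := by
    refine sum_subset (range_subset_range.2 (by omega)) fun j _ hj => ?_
    rw [msn_eq_zero_of_lt (by simp at hj; omega)]
    simp
  rw [h1, h2]

section NormedRing

variable {R : Type*} [NormedRing R] [NormedAlgebra ℝ R] [CompleteSpace R]

/-- The negative binomial series `∑ l, (l + r).choose r • a ^ l = x ^ (r + 1)`, where `x` is the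
sum of the geometric series; it is obtained from it by repeated Cauchy products. -/
theorem hasSum_choose_smul_pow {a x : R} (hs : Summable fun n : ℕ => ‖a ^ n‖)
    (hx : HasSum (fun n : ℕ => a ^ n) x) (r : ℕ) :
    (Summable fun l : ℕ => ‖((l + r).choose r : ℝ) • a ^ l‖) ∧
      HasSum (fun l : ℕ => ((l + r).choose r : ℝ) • a ^ l) (x ^ (r + 1)) := by
  induction r with
  | zero => simpa using ⟨hs, hx⟩
  | succ r ih =>
    have key : ∀ n : ℕ, ∑ kl ∈ antidiagonal n,
        (((kl.1 + r).choose r : ℝ) • a ^ kl.1) * a ^ kl.2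
          = ((n + (r + 1)).choose (r + 1) : ℝ) • a ^ n := by
      intro n
      have : ∀ kl ∈ antidiagonal n, (((kl.1 + r).choose r : ℝ) • a ^ kl.1) * a ^ kl.2
          = ((kl.1 + r).choose r : ℝ) • a ^ n := by
        intro kl hkl
        rw [smul_mul_assoc, ← pow_add, mem_antidiagonal.1 hkl]
      rw [sum_congr rfl this, ← sum_smul, Finset.Nat.sum_antidiagonal_eq_sum_range_succ_mk]
      congr 1
      have := Nat.sum_range_add_choose n r
      rw [← add_assoc, ← this]
      push_cast
      rfl
    have h1 := summable_norm_sum_mul_antidiagonal_of_summable_norm ih.1 hs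
    have h2 := tsum_mul_tsum_eq_tsum_sum_antidiagonal_of_summable_norm ih.1 hs
    simp only [key] at h1 h2
    refine ⟨h1, ?_⟩
    rw [ih.2.tsum_eq, hx.tsum_eq, ← pow_succ] at h2
    rw [h2]
    exact h1.of_norm.hasSum

/-- The `m`-th moment of the negative binomial series, shifted by `κ`. -/
theorem hasSum_add_pow_mul_choose_smul_pow {a x : R} (hs : Summable fun n : ℕ => ‖a ^ n‖)
    (hx : HasSum (fun n : ℕ => a ^ n) x) (κ : ℝ) (m r : ℕ) :
    HasSum (fun l : ℕ => (((l : ℝ) + κ) ^ m * ((l + r).choose r : ℝ)) • a ^ l)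
      (∑ j ∈ range (m + 1),
        (msn m j κ * ((j + r).choose j : ℝ)) • (a ^ j * x ^ (j + r + 1))) := by
  have h : ∀ j : ℕ, HasSum
      (fun l : ℕ => ((l.choose j : ℝ) * ((l + r).choose r : ℝ)) • a ^ l)
      (((j + r).choose j : ℝ) • (a ^ j * x ^ (j + r + 1))) := by
    intro j
    have hinj : Function.Injective fun i : ℕ => i + j := add_left_injective j
    rw [← hinj.hasSum_iff]
    · have h1 := ((hasSum_choose_smul_pow hs hx (j + r)).2.mul_left (a ^ j)).const_smul
        ((j + r).choose j : ℝ)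
      refine h1.congr_fun ?_
      intro i
      have h2 : (i + j).choose j * (i + j + r).choose r
          = (j + r).choose j * (i + (j + r)).choose (j + r) := by
        have h3 := Nat.choose_mul (n := i + (j + r)) (k := j + r) (s := r) (by omega)
        rw [show i + (j + r) - r = i + j by omega, show j + r - r = j by omega,
          ← Nat.choose_symm_add (a := j)] at h3
        rw [show i + j + r = i + (j + r) by omega, mul_comm, ← h3, mul_comm]
      have h4 : ((i + j).choose j : ℝ) * ((i + j + r).choose r : ℝ)
          = ((j + r).choose j : ℝ) * ((i + (j + r)).choose (j + r) : ℝ) := by exact_mod_cast h2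
      simp only [Function.comp_apply]
      rw [h4, mul_smul_comm, smul_smul, ← pow_add, add_comm j i]
    · intro l hl
      rw [Nat.choose_eq_zero_of_lt]
      · simp
      · by_contra hlt
        exact hl ⟨l - j, by simp; omega⟩
  have h1 := hasSum_sum (s := range (m + 1)) fun j _ => (h j).const_smul (msn m j κ)
  simp only [smul_smul] at h1
  refine h1.congr_fun fun l => ?_
  rw [add_pow_eq_sum_choose_mul_msn, sum_mul, sum_smul]
  refine sum_congr rfl fun j _ => ?_
  rw [mul_assoc, mul_left_comm]

end NormedRing

/-! ### Powers of substochastic matrices -/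

section Substochastic

variable {ι : Type*} [Fintype ι] [DecidableEq ι] {A : Matrix ι ι ℝ}

theorem pow_apply_mem_Icc_of_substochastic (h0 : ∀ i j, 0 ≤ A i j) (h1 : ∀ i, ∑ j, A i j ≤ 1)
    (n : ℕ) (i j : ι) : (A ^ n) i j ∈ Set.Icc (0 : ℝ) 1 := by
  induction n generalizing i with
  | zero =>
    rw [pow_zero, Matrix.one_apply]
    split_ifs <;> simp
  | succ n ih =>
    rw [pow_succ', Matrix.mul_apply]
    refine ⟨sum_nonneg fun l _ => mul_nonneg (h0 i l) (ih l).1, le_trans ?_ (h1 i)⟩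
    exact sum_le_sum fun l _ => mul_le_of_le_one_right (h0 i l) (ih l).2

/-- The Neumann series of a substochastic matrix `A` converges as soon as `1 - A` is invertible:
its partial sums `(1 - A ^ N) * (1 - A)⁻¹` have nonnegative, bounded entries. No norm of `A`
need be smaller than `1`. -/
theorem hasSum_pow_of_substochastic (h0 : ∀ i j, 0 ≤ A i j) (h1 : ∀ i, ∑ j, A i j ≤ 1)
    (hinv : IsUnit (1 - A)) : HasSum (fun n : ℕ => A ^ n) (1 - A)⁻¹ := by
  have hdet : IsUnit (1 - A).det := (Matrix.isUnit_iff_isUnit_det _).1 hinv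
  have hpart : ∀ N, ∑ l ∈ range N, A ^ l = (1 - A ^ N) * (1 - A)⁻¹ := fun N => by
    rw [← geom_sum_mul_neg, Matrix.mul_nonsing_inv_cancel_right _ _ hdet]
  have hs : Summable fun n : ℕ => A ^ n := by
    refine Pi.summable.2 fun i => Pi.summable.2 fun j => ?_
    refine summable_of_sum_range_le (c := ∑ l, |(1 - A)⁻¹ l j|)
      (fun n => (pow_apply_mem_Icc_of_substochastic h0 h1 n i j).1) fun N => ?_
    rw [← Matrix.sum_apply, hpart, Matrix.mul_apply]
    refine sum_le_sum fun l _ => (le_abs_self _).trans ?_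
    rw [abs_mul]
    refine mul_le_of_le_one_left (abs_nonneg _) ?_
    have h2 := pow_apply_mem_Icc_of_substochastic h0 h1 N i l
    have h3 := pow_apply_mem_Icc_of_substochastic h0 h1 0 i l
    rw [pow_zero] at h3
    rw [Matrix.sub_apply, abs_le]
    constructor <;> linarith [h2.1, h2.2, h3.1, h3.2]
  have hx : (1 - A) * ∑' n : ℕ, A ^ n = 1 := by
    have h2 := hs.tsum_eq_zero_add
    simp only [pow_succ', pow_zero, hs.tsum_mul_left] at h2
    rw [sub_mul, one_mul, sub_eq_iff_eq_add]
    exact h2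
  rw [Matrix.inv_eq_right_inv hx]
  exact hs.hasSum

/-- The moments of the negative binomial series of a substochastic matrix. -/
theorem hasSum_moment_of_substochastic (h0 : ∀ i j, 0 ≤ A i j) (h1 : ∀ i, ∑ j, A i j ≤ 1)
    (hinv : IsUnit (1 - A)) (κ : ℝ) (m r : ℕ) :
    HasSum (fun l : ℕ => (((l : ℝ) + κ) ^ m * ((l + r).choose r : ℝ)) • A ^ l)
      (∑ j ∈ range (m + 1),
        (msn m j κ * ((j + r).choose j : ℝ)) • (A ^ j * (1 - A)⁻¹ ^ (j + r + 1))) := by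
  have hx := hasSum_pow_of_substochastic h0 h1 hinv
  -- all norms on matrices are equivalent; the `ℓ^∞` operator norm is submultiplicative
  let _ : NormedRing (Matrix ι ι ℝ) := Matrix.linftyOpNormedRing
  let _ : NormedAlgebra ℝ (Matrix ι ι ℝ) := Matrix.linftyOpNormedAlgebra
  have hs : Summable fun n : ℕ => ‖A ^ n‖ := hx.summable.norm
  exact hasSum_add_pow_mul_choose_smul_pow hs hx κ m r

end Substochastic

/-! ### Visits and passage times -/

section Visits

variable {S Ω : Type*} [DecidableEq S] (X : ℕ → Ω → S) (T : Finset S)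

theorem visits_zero (ω : Ω) : visits X T 0 ω = if X 0 ω ∈ T then 1 else 0 := by
  rw [visits, card_filter, sum_range_one]

theorem visits_succ (n : ℕ) (ω : Ω) :
    visits X T (n + 1) ω = visits X T n ω + if X (n + 1) ω ∈ T then 1 else 0 := by
  simp only [visits, card_filter]
  rw [sum_range_succ]

theorem visits_mono (ω : Ω) : Monotone fun n => visits X T n ω :=
  monotone_nat_of_le_succ fun n => by rw [visits_succ]; exact Nat.le_add_right _ _

/-- The number of visits up to time `n` is a function of the path up to time `n`. -/
theorem visits_congr {n : ℕ} {ω ω' : Ω} (h : ∀ t ≤ n, X t ω = X t ω') :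
    visits X T n ω = visits X T n ω' := by
  simp only [visits]
  congr 1
  refine filter_congr fun t ht => ?_
  rw [h t (by simp at ht; omega)]

/-- If the chain is in `T` at time `n`, then `n` is the `k`-th passage time into `T` exactly when
there have been `k` visits up to time `n`: the visit at time `n` makes the count increase. -/
theorem passageTime_eq_iff {n k : ℕ} {ω : Ω} (h : X n ω ∈ T) :
    passageTime X T k ω = n ↔ visits X T n ω = k := by
  have hlt : ∀ r < n, visits X T r ω < visits X T n ω := by
    intro r hr
    obtain ⟨n, rfl⟩ : ∃ n', n = n' + 1 := ⟨n - 1, by omega⟩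
    rw [visits_succ, if_pos h]
    exact Nat.lt_succ_of_le (visits_mono X T ω (Nat.lt_succ_iff.1 hr))
  constructor
  · intro hp
    have hne : ∃ r, visits X T r ω = k := by
      by_contra hcon
      push Not at hcon
      have : passageTime X T k ω = ⊤ := by
        simp only [passageTime, iInf_eq_top]
        exact fun r hr => absurd hr (hcon r)
      rw [this] at hp
      exact ENat.natCast_ne_top n hp.symm
    -- the infimum is attained, at the least `r` with `visits X T r ω = k`
    have hfind : passageTime X T k ω = (Nat.find hne : ℕ∞) := by
      refine le_antisymm (iInf₂_le (Nat.find hne) (Nat.find_spec hne)) (le_iInf₂ fun r hr => ?_)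
      exact_mod_cast Nat.find_min' hne hr
    rw [hfind] at hp
    rw [← Nat.cast_injective hp]
    exact Nat.find_spec hne
  · intro hv
    refine le_antisymm (iInf₂_le n hv) (le_iInf₂ fun r hr => ?_)
    by_contra hcon
    have hrn : r < n := by exact_mod_cast not_le.1 hcon
    exact (hlt r hrn).ne (hr.trans hv.symm)

end Visits

section VisitBlock

variable {S Ω : Type*} [Fintype S] [DecidableEq S] [MeasurableSpace Ω] {ℙ : S → Measure Ω}
  {X : ℕ → Ω → S}

/-- The probability, starting in `i`, of `k` visits to `T` up to time `n` and of being in `a` at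
time `n`. -/
def visitProb (ℙ : S → Measure Ω) (X : ℕ → Ω → S) (T : Finset S) (k n : ℕ) (i a : S) : ℝ :=
  (ℙ i).real {ω | visits X T n ω = k ∧ X n ω = a}

/-- The block of `visitProb` with starting states in `M` and final states in `B`, where the visits
to the complement of `M` are counted. -/
def visitBlock (ℙ : S → Measure Ω) (X : ℕ → Ω → S) (M B : Finset S) (k n : ℕ) : Matrix M B ℝ :=
  Matrix.of fun i j => visitProb ℙ X Mᶜ k n i j

/-- The infimum defining the passage time disappears: as the chain ends in the complement of `M`,
it is enough to count visits. -/
theorem passageProb_eq_visitBlock (M : Finset S) (k n : ℕ) :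
    passageProb ℙ X M k n = visitBlock ℙ X M Mᶜ k n := by
  ext i j
  simp only [passageProb, visitBlock, visitProb, Matrix.of_apply]
  congr 1
  ext ω
  simp only [Set.mem_ofPred_eq]
  constructor
  · rintro ⟨h1, h2⟩
    exact ⟨(passageTime_eq_iff X Mᶜ (by rw [h2]; exact j.2)).1 h1, h2⟩
  · rintro ⟨h1, h2⟩
    exact ⟨(passageTime_eq_iff X Mᶜ (by rw [h2]; exact j.2)).2 h1, h2⟩

theorem visitBlock_zero_visits (M : Finset S) (n : ℕ) : visitBlock ℙ X M Mᶜ 0 n = 0 := by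
  ext i j
  have : {ω | visits X Mᶜ n ω = 0 ∧ X n ω = j} = ∅ := by
    refine Set.eq_empty_of_forall_notMem fun ω hω => ?_
    have h : n ∈ ({t ∈ range (n + 1) | X t ω ∈ (Mᶜ : Finset S)} : Finset ℕ) := by
      rw [mem_filter, hω.2]
      exact ⟨self_mem_range_succ n, j.2⟩
    rw [card_eq_zero.1 hω.1] at h
    simp at h
  simp only [visitBlock, visitProb, Matrix.of_apply, this]
  simp

theorem sum_eq_block_add_block (M : Finset S) (f : S → ℝ) :
    ∑ a, f a = ∑ a : M, f a + ∑ a : (Mᶜ : Finset S), f a := by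
  rw [sum_coe_sort M f, sum_coe_sort Mᶜ f, sum_add_sum_compl]

end VisitBlock

/-! ### The Markov property for the number of visits -/

section Markov

variable {S Ω : Type*} [MeasurableSpace S] [MeasurableSpace Ω] {P : Matrix S S ℝ}
  {ℙ : S → Measure Ω} {X : ℕ → Ω → S}

section

variable [DecidableEq S]

theorem visitProb_zero (hX : IsMarkovFamily P ℙ X) (T : Finset S) (k : ℕ) {i : S} (hi : i ∉ T)
    (a : S) : visitProb ℙ X T k 0 i a = if k = 0 ∧ i = a then 1 else 0 := by
  have := hX.isProbability i
  have h : {ω | visits X T 0 ω = k ∧ X 0 ω = a} =ᵐ[ℙ i] {_ω : Ω | k = 0 ∧ i = a} := by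
    filter_upwards [hX.start i] with ω hω
    refine propext ?_
    change (visits X T 0 ω = k ∧ X 0 ω = a) ↔ (k = 0 ∧ i = a)
    rw [visits_zero, hω, if_neg hi, eq_comm (a := 0)]
  rw [visitProb, measureReal_congr h]
  split_ifs with h2
  · have huniv : {_ω : Ω | k = 0 ∧ i = a} = Set.univ := Set.eq_univ_of_forall fun _ => h2
    rw [huniv, probReal_univ]
  · simp only [h2, Set.ofPred_false, measureReal_empty]

variable [Fintype S]

theorem visitBlock_zero_left (hX : IsMarkovFamily P ℙ X) (M : Finset S) (k : ℕ) :
    visitBlock ℙ X M M k 0 = if k = 0 then 1 else 0 := by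
  ext i j
  rw [visitBlock, Matrix.of_apply, visitProb_zero hX Mᶜ k (by simp)]
  split_ifs with h1 h2 h2
  · rw [Subtype.ext h1.2, Matrix.one_apply_eq]
  · tauto
  · rw [Matrix.one_apply_ne]
    rintro rfl
    exact h1 ⟨h2, rfl⟩
  · rfl

theorem visitBlock_zero_right (hX : IsMarkovFamily P ℙ X) (M : Finset S) (k : ℕ) :
    visitBlock ℙ X M Mᶜ k 0 = 0 := by
  ext i j
  rw [visitBlock, Matrix.of_apply, visitProb_zero hX Mᶜ k (by simp), if_neg]
  · rfl
  · rintro ⟨-, h⟩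
    have := j.2
    rw [← h] at this
    simp at this

end

variable [Fintype S] [DiscreteMeasurableSpace S]

/-- The Markov property for an event `{V = v}` of the past, where `V` is a function of
`X 0, …, X n`: such an event is a finite disjoint union of path events. -/
theorem IsMarkovFamily.real_inter_succ (hX : IsMarkovFamily P ℙ X) (i : S) (n : ℕ)
    {β : Type*} (V : Ω → β) (hV : ∀ ω ω', (∀ t ≤ n, X t ω = X t ω') → V ω = V ω')
    (v : β) (a b : S) :
    (ℙ i).real {ω | V ω = v ∧ X n ω = a ∧ X (n + 1) ω = b}
      = (ℙ i).real {ω | V ω = v ∧ X n ω = a} * P a b := by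
  classical
  have := hX.isProbability i
  let Y : Ω → (Fin (n + 1) → S) := fun ω t => X t ω
  have hY : Measurable Y := measurable_pi_lambda _ fun t => hX.measurable t
  have hpath : ∀ (y : Fin (n + 1) → S) (ω : Ω),
      Y ω = y ↔ ∀ t ≤ n, X t ω = if h : t < n + 1 then y ⟨t, h⟩ else b := by
    intro y ω
    constructor
    · rintro rfl t ht
      rw [dif_pos (Nat.lt_succ_of_le ht)]
    · intro h
      funext t
      have := h t (Nat.lt_succ_iff.1 t.2)
      rw [dif_pos t.2] at this
      exact this
  -- `W` is the set of paths up to time `n` that realise the past event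
  let W : Finset (Fin (n + 1) → S) := {y | ∃ ω, Y ω = y ∧ V ω = v ∧ X n ω = a}
  have hW : ∀ ω, Y ω ∈ W ↔ V ω = v ∧ X n ω = a := by
    intro ω
    simp only [W, mem_filter, mem_univ, true_and]
    constructor
    · rintro ⟨ω', h1, h2, h3⟩
      have h4 : ∀ t ≤ n, X t ω = X t ω' := fun t ht =>
        (congrFun h1 ⟨t, Nat.lt_succ_of_le ht⟩).symm
      exact ⟨(hV _ _ h4).trans h2, (h4 n le_rfl).trans h3⟩
    · exact fun h => ⟨ω, rfl, h⟩
  have hYy : ∀ y ∈ W, MeasurableSet (Y ⁻¹' {y}) := fun y _ => hY (measurableSet_singleton y)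
  have e1 : {ω | V ω = v ∧ X n ω = a} = Y ⁻¹' (W : Set (Fin (n + 1) → S)) := by
    ext ω; exact (hW ω).symm
  have e2 : {ω | V ω = v ∧ X n ω = a ∧ X (n + 1) ω = b}
      = Y ⁻¹' (W : Set (Fin (n + 1) → S)) ∩ {ω | X (n + 1) ω = b} := by
    rw [← e1]; ext ω; simp [and_assoc]
  have hYW : MeasurableSet (Y ⁻¹' (W : Set (Fin (n + 1) → S))) := hY W.measurableSet
  rw [e2, e1, ← measureReal_restrict_apply hYW, ← sum_measureReal_preimage_singleton W hYy,
    ← sum_measureReal_preimage_singleton W hYy, sum_mul]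
  refine sum_congr rfl fun y hy => ?_
  rw [measureReal_restrict_apply (hYy y hy)]
  -- the path `y`, continued by `b` at time `n + 1`
  have hm := hX.markov i n fun t => if h : t < n + 1 then y ⟨t, h⟩ else b
  have hya : y ⟨n, n.lt_succ_self⟩ = a := by
    simp only [W, mem_filter, mem_univ, true_and] at hy
    obtain ⟨ω, rfl, -, h⟩ := hy
    exact h
  rw [dif_pos n.lt_succ_self, dif_neg (lt_irrefl _), hya] at hm
  convert hm using 2
  · ext ω
    simp only [Set.mem_inter_iff, Set.mem_preimage, Set.mem_singleton_iff, Set.mem_ofPred_eq, hpath]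
    constructor
    · rintro ⟨h1, h2⟩ t ht
      rcases Nat.lt_succ_iff_lt_or_eq.1 (Nat.lt_succ_of_le ht) with h | rfl
      · exact h1 t (Nat.lt_succ_iff.1 h)
      · rw [h2, dif_neg (lt_irrefl _)]
    · intro h
      refine ⟨fun t ht => h t (by omega), ?_⟩
      rw [h (n + 1) le_rfl, dif_neg (lt_irrefl _)]
  · congr 1
    ext ω
    simp only [Set.mem_preimage, Set.mem_singleton_iff, Set.mem_ofPred_eq, hpath]

variable [DecidableEq S]

/-- Conditioning on the state at time `n`. -/
theorem sum_visitProb_mul (hX : IsMarkovFamily P ℙ X) (T : Finset S) (k n : ℕ) (i b : S) :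
    (ℙ i).real {ω | visits X T n ω = k ∧ X (n + 1) ω = b}
      = ∑ a, visitProb ℙ X T k n i a * P a b := by
  have := hX.isProbability i
  have hXa : ∀ a ∈ (univ : Finset S), MeasurableSet (X n ⁻¹' {a}) := fun a _ =>
    hX.measurable n (MeasurableSet.of_discrete)
  have h1 := sum_measureReal_preimage_singleton
    (μ := (ℙ i).restrict {ω | visits X T n ω = k ∧ X (n + 1) ω = b}) univ hXa
  simp only [coe_univ, Set.preimage_univ, measureReal_restrict_apply MeasurableSet.univ,
    Set.univ_inter] at h1
  rw [← h1]
  refine sum_congr rfl fun a ha => ?_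
  rw [measureReal_restrict_apply (hXa a ha), visitProb, ← hX.real_inter_succ i n
    (fun ω => visits X T n ω) (fun _ _ => visits_congr X T) k a b]
  congr 1
  ext ω
  simp only [Set.mem_inter_iff, Set.mem_preimage, Set.mem_singleton_iff, Set.mem_ofPred_eq]
  tauto

/-- A step into `M` leaves the number of visits to the complement unchanged. -/
theorem visitBlock_succ_left (hX : IsMarkovFamily P ℙ X) (M : Finset S) (k n : ℕ) :
    visitBlock ℙ X M M k (n + 1)
      = visitBlock ℙ X M M k n * block P M M + visitBlock ℙ X M Mᶜ k n * block P Mᶜ M := by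
  ext i j
  simp only [Matrix.add_apply, Matrix.mul_apply, visitBlock, block, Matrix.of_apply]
  rw [← sum_eq_block_add_block M fun a => visitProb ℙ X Mᶜ k n i a * P a j,
    ← sum_visitProb_mul hX, visitProb]
  congr 1
  ext ω
  refine and_congr_left fun h => ?_
  rw [visits_succ, h, if_neg (by simp), add_zero]

/-- A step into the complement of `M` adds one visit to it. -/
theorem visitBlock_succ_right (hX : IsMarkovFamily P ℙ X) (M : Finset S) (k n : ℕ) :
    visitBlock ℙ X M Mᶜ (k + 1) (n + 1)
      = visitBlock ℙ X M M k n * block P M Mᶜ + visitBlock ℙ X M Mᶜ k n * block P Mᶜ Mᶜ := by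
  ext i j
  simp only [Matrix.add_apply, Matrix.mul_apply, visitBlock, block, Matrix.of_apply]
  rw [← sum_eq_block_add_block M fun a => visitProb ℙ X Mᶜ k n i a * P a j,
    ← sum_visitProb_mul hX, visitProb]
  congr 1
  ext ω
  refine and_congr_left fun h => ?_
  rw [visits_succ, h, if_pos j.2, Nat.add_right_cancel_iff]

end Markov

/-! ### Closed form of the recursion for the blocks -/

section ClosedForm

variable {ι κ : Type*} [Fintype ι] [DecidableEq ι] [Fintype κ]
  {A : Matrix ι ι ℝ} {B : Matrix ι κ ℝ} {C : Matrix κ κ ℝ} {D : Matrix κ ι ℝ}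

variable {a : ℕ → ℕ → Matrix ι ι ℝ} {c : ℕ → ℕ → Matrix ι κ ℝ}

/-- The `k`-th block vanishes before time `k`: there is at most one visit per unit of time. -/
theorem block_recursion_eq_zero_of_lt (ha0 : ∀ k, a k 0 = if k = 0 then 1 else 0)
    (hc0 : ∀ k, c k 0 = 0)
    (ha : ∀ k n, a k (n + 1) = a k n * A + c k n * D)
    (hc : ∀ k n, c (k + 1) (n + 1) = a k n * B + c k n * C) (n : ℕ) :
    ∀ k, n < k → a k n = 0 ∧ c k n = 0 := by
  induction n with
  | zero => exact fun k hk => ⟨by rw [ha0, if_neg hk.ne'], hc0 k⟩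
  | succ n ih =>
    intro k hk
    obtain ⟨k, rfl⟩ : ∃ k', k = k' + 1 := ⟨k - 1, by omega⟩
    obtain ⟨h1, h2⟩ := ih k (by omega)
    obtain ⟨h3, h4⟩ := ih (k + 1) (by omega)
    exact ⟨by rw [ha, h3, h4, Matrix.zero_mul, Matrix.zero_mul, add_zero],
      by rw [hc, h1, h2, Matrix.zero_mul, Matrix.zero_mul, add_zero]⟩

theorem block_recursion_zero (ha0 : ∀ k, a k 0 = if k = 0 then 1 else 0)
    (hcz : ∀ n, c 0 n = 0) (ha : ∀ k n, a k (n + 1) = a k n * A + c k n * D) (n : ℕ) :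
    a 0 n = A ^ n := by
  induction n with
  | zero => rw [ha0, if_pos rfl, pow_zero]
  | succ n ih => rw [ha, ih, hcz, Matrix.zero_mul, add_zero, pow_succ]

variable [DecidableEq κ]

/-- Powers of `A` may be moved to the left across any number of excursions `D * B`. -/
theorem mul_pow_mul_pow_mul_comm
    (hA : ∀ r s : ℕ, B * C ^ s * D * A ^ r * B = A ^ r * B * C ^ s * D * B) (r s t : ℕ) :
    B * C ^ s * (D * B) ^ r * D * A ^ t * B = A ^ t * B * C ^ s * (D * B) ^ (r + 1) := by
  induction r with
  | zero =>
    rw [pow_zero, Matrix.mul_one, hA, zero_add, pow_one]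
    simp only [Matrix.mul_assoc]
  | succ r ih =>
    have h0 := hA t 0
    rw [pow_zero, Matrix.mul_one, Matrix.mul_one] at h0
    calc B * C ^ s * (D * B) ^ (r + 1) * D * A ^ t * B
        = B * C ^ s * (D * B) ^ r * D * (B * D * A ^ t * B) := by
          rw [pow_succ]; simp only [Matrix.mul_assoc]
      _ = B * C ^ s * (D * B) ^ r * D * A ^ t * B * (D * B) := by
          rw [h0]; simp only [Matrix.mul_assoc]
      _ = A ^ t * B * C ^ s * (D * B) ^ (r + 1 + 1) := by
          rw [ih, pow_succ (D * B) (r + 1)]; simp only [Matrix.mul_assoc]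

/-- Closed form for the blocks `a`, after multiplication by `A ^ t * B`, in terms of that for the
blocks `c`. Where `r < l` fails, the exponent `l - (r + 1)` is truncated, but the binomial
coefficient vanishes. -/
theorem block_recursion_left (hA : ∀ r s : ℕ, B * C ^ s * D * A ^ r * B = A ^ r * B * C ^ s * D * B)
    (ha : ∀ k n, a k (n + 1) = a k n * A + c k n * D)
    (hzero : ∀ n k, n < k → a k n = 0 ∧ c k n = 0) (k : ℕ)
    (hck : ∀ l, c (k + 1) (k + 1 + l) = ∑ r ∈ range (k + 1),
      ((k.choose r : ℝ) * (l.choose r : ℝ)) • (A ^ (l - r) * B * C ^ (k - r) * (D * B) ^ r))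
    (l : ℕ) : ∀ t, a (k + 1) (k + 1 + l) * A ^ t * B = ∑ r ∈ range (k + 1),
      ((k.choose r : ℝ) * (l.choose (r + 1) : ℝ)) •
        (A ^ (l - (r + 1) + t) * B * C ^ (k - r) * (D * B) ^ (r + 1)) := by
  induction l with
  | zero =>
    intro t
    obtain ⟨h1, h2⟩ := hzero k (k + 1) (by omega)
    rw [add_zero, ha, h1, h2]
    simp
  | succ l ih =>
    intro t
    have h1 : a (k + 1) (k + 1 + (l + 1)) * A ^ t * B
        = a (k + 1) (k + 1 + l) * A ^ (t + 1) * B + c (k + 1) (k + 1 + l) * D * A ^ t * B := by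
      rw [← add_assoc, ha, pow_succ']
      simp only [Matrix.add_mul, Matrix.mul_assoc]
    rw [h1, ih, hck]
    simp only [Matrix.sum_mul, Matrix.smul_mul]
    rw [← sum_add_distrib]
    refine sum_congr rfl fun r _ => ?_
    have h2 : A ^ (l - r) * B * C ^ (k - r) * (D * B) ^ r * D * A ^ t * B
        = A ^ (l - r + t) * B * C ^ (k - r) * (D * B) ^ (r + 1) := by
      have := mul_pow_mul_pow_mul_comm hA r (k - r) t
      rw [pow_add]
      simp only [Matrix.mul_assoc] at this ⊢
      rw [this]
    rw [h2, Nat.choose_succ_succ, Nat.cast_add, mul_add, add_smul, add_comm,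
      show l + 1 - (r + 1) = l - r by omega]
    congr 1
    rcases lt_or_ge l (r + 1) with h | h
    · rw [Nat.choose_eq_zero_of_lt h]; simp
    · rw [show l - (r + 1) + (t + 1) = l - r + t by omega]

/-- Closed form for the blocks `c`, by induction on `k`: the two terms of the recursion combine by
Pascal's rule. -/
theorem block_recursion_right
    (hA : ∀ r s : ℕ, B * C ^ s * D * A ^ r * B = A ^ r * B * C ^ s * D * B)
    (hC : Commute C (D * B))
    (ha0 : ∀ k, a k 0 = if k = 0 then 1 else 0) (hcz : ∀ n, c 0 n = 0)
    (ha : ∀ k n, a k (n + 1) = a k n * A + c k n * D)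
    (hc : ∀ k n, c (k + 1) (n + 1) = a k n * B + c k n * C)
    (hzero : ∀ n k, n < k → a k n = 0 ∧ c k n = 0) (k : ℕ) :
    ∀ l, c (k + 1) (k + 1 + l) = ∑ r ∈ range (k + 1),
      ((k.choose r : ℝ) * (l.choose r : ℝ)) •
        (A ^ (l - r) * B * C ^ (k - r) * (D * B) ^ r) := by
  induction k with
  | zero =>
    intro l
    rw [show 0 + 1 + l = l + 1 by omega, hc, hcz, block_recursion_zero ha0 hcz ha]
    simp
  | succ k ih =>
    intro l
    have hleft := block_recursion_left hA ha hzero k ih l 0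
    rw [pow_zero, Matrix.mul_one] at hleft
    rw [show k + 1 + 1 + l = k + 1 + l + 1 by omega, hc, hleft, ih, Matrix.sum_mul,
      sum_range_succ' _ (k + 1)]
    have h1 : ∀ r ∈ range (k + 1),
        (((k + 1).choose (r + 1) : ℝ) * (l.choose (r + 1) : ℝ)) •
          (A ^ (l - (r + 1)) * B * C ^ (k + 1 - (r + 1)) * (D * B) ^ (r + 1))
        = ((k.choose r : ℝ) * (l.choose (r + 1) : ℝ)) •
            (A ^ (l - (r + 1) + 0) * B * C ^ (k - r) * (D * B) ^ (r + 1))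
          + ((k.choose (r + 1) : ℝ) * (l.choose (r + 1) : ℝ)) •
            (A ^ (l - (r + 1)) * B * C ^ (k + 1 - (r + 1)) * (D * B) ^ (r + 1)) := by
      intro r _
      rw [Nat.choose_succ_succ, Nat.cast_add, add_mul, add_smul, Nat.add_sub_add_right, add_zero]
    rw [sum_congr rfl h1, sum_add_distrib, add_assoc]
    congr 1
    have h2 := sum_range_succ' (fun r => ((k.choose r : ℝ) * (l.choose r : ℝ)) •
        (A ^ (l - r) * B * C ^ (k + 1 - r) * (D * B) ^ r)) (k + 1)
    rw [sum_range_succ _ (k + 1), Nat.choose_succ_self] at h2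
    simp only [Nat.choose_zero_right] at h2 ⊢
    rw [← h2]
    simp only [Nat.cast_zero, zero_mul, zero_smul, add_zero]
    refine sum_congr rfl fun r hr => ?_
    rw [Matrix.smul_mul, Matrix.mul_assoc _ ((D * B) ^ r) C, ← (hC.pow_right r).eq,
      show k + 1 - r = k - r + 1 by simp at hr; omega, pow_succ C]
    simp only [Matrix.mul_assoc]

end ClosedForm

/-! ### Distribution and moments of the passage times -/

theorem hasSum_matrix_mul {α ι κ τ : Type*} [Fintype κ] {f : α → Matrix ι κ ℝ}
    {Z : Matrix ι κ ℝ} (h : HasSum f Z) (N : Matrix κ τ ℝ) :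
    HasSum (fun x => f x * N) (Z * N) :=
  h.map (Matrix.addMonoidHomMulRight N) (continuous_id.matrix_mul continuous_const)

section Block

variable {S : Type*} [Fintype S] [DecidableEq S] {P : Matrix S S ℝ} {M : Finset S}

theorem block_nonneg (hP : P ∈ Matrix.rowStochastic ℝ S) (U V : Finset S) (i : U) (j : V) :
    0 ≤ block P U V i j :=
  Matrix.nonneg_of_mem_rowStochastic hP

theorem sum_block_add_sum_block_compl (hP : P ∈ Matrix.rowStochastic ℝ S) (U : Finset S) (i : U) :
    ∑ j, block P U M i j + ∑ j, block P U Mᶜ i j = 1 := by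
  rw [← Matrix.sum_row_of_mem_rowStochastic hP i, sum_eq_block_add_block M]
  rfl

theorem sum_block_le_one (hP : P ∈ Matrix.rowStochastic ℝ S) (i : M) :
    ∑ j, block P M M i j ≤ 1 := by
  rw [← sum_block_add_sum_block_compl (M := M) hP M i]
  exact le_add_of_nonneg_right (sum_nonneg fun j _ => block_nonneg hP M Mᶜ i j)

end Block

section Passage

variable {S Ω : Type*} [Fintype S] [DecidableEq S] [MeasurableSpace S]
  [DiscreteMeasurableSpace S] [MeasurableSpace Ω] {P : Matrix S S ℝ} {ℙ : S → Measure Ω}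
  {X : ℕ → Ω → S} {M : Finset S}

theorem passageProb_eq_zero_of_lt (hX : IsMarkovFamily P ℙ X) {k n : ℕ} (h : n < k) :
    passageProb ℙ X M k n = 0 := by
  rw [passageProb_eq_visitBlock]
  exact (block_recursion_eq_zero_of_lt (visitBlock_zero_left hX M) (visitBlock_zero_right hX M)
    (visitBlock_succ_left hX M) (visitBlock_succ_right hX M)
    n k h).2

/-- The distribution of the passage times. The hypotheses follow from commutability with respect
to `M` and its complement, but also hold in the phase-type case. -/
theorem passageProb_succ_add (hX : IsMarkovFamily P ℙ X)
    (hA : ∀ r s : ℕ, block P M Mᶜ * block P Mᶜ Mᶜ ^ s * block P Mᶜ M * block P M M ^ r *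
      block P M Mᶜ = block P M M ^ r * block P M Mᶜ * block P Mᶜ Mᶜ ^ s * block P Mᶜ M *
      block P M Mᶜ)
    (hC : Commute (block P Mᶜ Mᶜ) (block P Mᶜ M * block P M Mᶜ)) (k l : ℕ) :
    passageProb ℙ X M (k + 1) (k + 1 + l) = ∑ r ∈ range (k + 1),
      ((k.choose r : ℝ) * (l.choose r : ℝ)) • (block P M M ^ (l - r) * block P M Mᶜ *
        block P Mᶜ Mᶜ ^ (k - r) * (block P Mᶜ M * block P M Mᶜ) ^ r) := by
  rw [passageProb_eq_visitBlock]
  exact block_recursion_right (c := fun k n => visitBlock ℙ X M Mᶜ k n) hA hC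
    (visitBlock_zero_left hX M) (visitBlock_zero_visits M) (visitBlock_succ_left hX M)
    (visitBlock_succ_right hX M) (block_recursion_eq_zero_of_lt (visitBlock_zero_left hX M)
      (visitBlock_zero_right hX M) (visitBlock_succ_left hX M)
      (visitBlock_succ_right hX M)) k l

/-- The moment series may be started at time `k`. -/
theorem hasPassageMoment_iff (hX : IsMarkovFamily P ℙ X) (k m : ℕ)
    (Z : Matrix M (Mᶜ : Finset S) ℝ) :
    HasPassageMoment ℙ X M k m Z ↔
      HasSum (fun l : ℕ => ((l : ℝ) + k) ^ m • passageProb ℙ X M k (k + l)) Z := by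
  have hinj : Function.Injective fun l : ℕ => k + l := add_right_injective k
  rw [HasPassageMoment, ← hinj.hasSum_iff]
  · have : (fun n : ℕ => (n : ℝ) ^ m • passageProb ℙ X M k n) ∘ (fun l : ℕ => k + l)
        = fun l : ℕ => ((l : ℝ) + k) ^ m • passageProb ℙ X M k (k + l) := by
      funext l
      simp [add_comm]
    rw [this]
  · intro n hn
    rw [passageProb_eq_zero_of_lt hX, smul_zero]
    by_contra hlt
    exact hn ⟨n - k, by simp; omega⟩

/-- The moments of the passage times, under the hypotheses of `passageProb_succ_add`. -/
theorem hasPassageMoment_of_comm (hP : P ∈ Matrix.rowStochastic ℝ S) (hX : IsMarkovFamily P ℙ X)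
    (hinv : IsUnit (1 - block P M M))
    (hA : ∀ r s : ℕ, block P M Mᶜ * block P Mᶜ Mᶜ ^ s * block P Mᶜ M * block P M M ^ r *
      block P M Mᶜ = block P M M ^ r * block P M Mᶜ * block P Mᶜ Mᶜ ^ s * block P Mᶜ M *
      block P M Mᶜ)
    (hC : Commute (block P Mᶜ Mᶜ) (block P Mᶜ M * block P M Mᶜ))
    (m : ℕ) {k : ℕ} (hk : 1 ≤ k) :
    HasPassageMoment ℙ X M k m
      (∑ r ∈ range k, ((k - 1).choose r : ℝ) • ∑ j ∈ range (m + 1),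
        (msn m j ((k : ℝ) + r) * ((j + r).choose j : ℝ)) •
          (block P M M ^ j * (1 - block P M M)⁻¹ ^ (j + r + 1) * block P M Mᶜ *
            block P Mᶜ Mᶜ ^ (k - 1 - r) * (block P Mᶜ M * block P M Mᶜ) ^ r)) := by
  obtain ⟨k, rfl⟩ : ∃ k', k = k' + 1 := ⟨k - 1, by omega⟩
  rw [hasPassageMoment_iff hX, Nat.add_sub_cancel]
  simp only [passageProb_succ_add hX hA hC, smul_sum]
  refine hasSum_sum fun r _ => ?_
  -- the summands with `l < r` vanish
  have hinj : Function.Injective fun i : ℕ => i + r := add_left_injective r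
  rw [← hinj.hasSum_iff]
  · have h := (hasSum_matrix_mul (hasSum_moment_of_substochastic (block_nonneg hP M M)
      (sum_block_le_one hP) hinv (((k + 1 : ℕ) : ℝ) + r) m r)
      (block P M Mᶜ * block P Mᶜ Mᶜ ^ (k - r) *
        (block P Mᶜ M * block P M Mᶜ) ^ r)).const_smul (k.choose r : ℝ)
    simp only [Matrix.sum_mul, Matrix.smul_mul, smul_sum] at h
    convert h using 1
    · funext i
      simp only [Function.comp_apply, smul_smul, Nat.add_sub_cancel, Matrix.mul_assoc]
      congr 1
      push_cast
      ring
    · simp only [Matrix.mul_assoc]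
  · intro l hl
    rw [Nat.choose_eq_zero_of_lt (n := l)]
    · simp
    · by_contra hlt
      exact hl ⟨l - r, by simp; omega⟩

end Passage

/-! ### The phase-type case -/

section PhaseType

variable {S : Type*} [Fintype S] [DecidableEq S] {P : Matrix S S ℝ} {M : Finset S} {q s : ℝ}

/-- The data of the phase-type case in terms of the all-ones matrix `E = of fun _ _ => 1`:
`P_M E = s E`, `P_{M M̄} = (1 - s) E`, `P_{M̄} = q I` and `P_{M̄ M} E = (1 - q) I`. -/
structure IsPhaseType (P : Matrix S S ℝ) (M : Finset S) (q s : ℝ) : Prop where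
  block_mul : block P M M * (Matrix.of fun _ _ => 1 : Matrix M (Mᶜ : Finset S) ℝ)
    = s • Matrix.of fun _ _ => 1
  block_compl : block P M Mᶜ = (1 - s) • Matrix.of fun _ _ => 1
  block_compl_compl : block P Mᶜ Mᶜ = q • 1
  block_compl_mul : block P Mᶜ M * (Matrix.of fun _ _ => 1 : Matrix M (Mᶜ : Finset S) ℝ)
    = (1 - q) • 1

theorem isPhaseType_of_card_eq_one (hP : P ∈ Matrix.rowStochastic ℝ S) (hcard : #(Mᶜ) = 1)
    (hq : block P Mᶜ Mᶜ = Matrix.of fun _ _ => q)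
    (hs : Matrix.mulVec (block P M M) (fun _ => 1) = s • (fun _ => 1)) : IsPhaseType P M q s := by
  have hsub : Subsingleton (Mᶜ : Finset S) :=
    Fintype.card_le_one_iff_subsingleton.1 (by rw [Fintype.card_coe, hcard])
  have hrow : ∀ i, ∑ j, block P M M i j = s := fun i => by
    simpa [Matrix.mulVec, dotProduct] using congrFun hs i
  have hsum : ∀ (f : (Mᶜ : Finset S) → ℝ) (j), ∑ i, f i = f j := fun f j =>
    Fintype.sum_subsingleton f j
  refine ⟨?_, ?_, ?_, ?_⟩
  · ext i j
    simp only [Matrix.mul_apply, Matrix.smul_apply, Matrix.of_apply, smul_eq_mul, mul_one, hrow]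
  · ext i j
    have := sum_block_add_sum_block_compl (M := M) hP M i
    rw [hrow, hsum _ j] at this
    simp only [Matrix.smul_apply, Matrix.of_apply, smul_eq_mul, mul_one]
    linarith
  · ext i j
    rw [hq, Subsingleton.elim i j]
    simp
  · ext i j
    have := sum_block_add_sum_block_compl (M := M) hP Mᶜ i
    rw [hq, hsum _ j] at this
    simp only [Matrix.of_apply] at this
    rw [Subsingleton.elim j i]
    simp only [Matrix.mul_apply, Matrix.smul_apply, Matrix.of_apply, smul_eq_mul, mul_one,
      Matrix.one_apply_eq]
    linarith

namespace IsPhaseType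

theorem block_pow_mul (h : IsPhaseType P M q s) (n : ℕ) :
    block P M M ^ n * (Matrix.of fun _ _ => 1 : Matrix M (Mᶜ : Finset S) ℝ)
      = s ^ n • Matrix.of fun _ _ => 1 := by
  induction n with
  | zero => simp
  | succ n ih =>
    rw [pow_succ, Matrix.mul_assoc, h.block_mul, Matrix.mul_smul, ih, smul_smul, ← pow_succ']

theorem excursion (h : IsPhaseType P M q s) :
    block P Mᶜ M * block P M Mᶜ = ((1 - s) * (1 - q)) • 1 := by
  rw [h.block_compl, Matrix.mul_smul, h.block_compl_mul, smul_smul]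

/-- The left commutation property holds although `M`-commutability itself may fail: only the action
of `P_M` on multiples of the all-ones matrix matters. -/
theorem comm_left (h : IsPhaseType P M q s) (r t : ℕ) :
    block P M Mᶜ * block P Mᶜ Mᶜ ^ t * block P Mᶜ M * block P M M ^ r * block P M Mᶜ
      = block P M M ^ r * block P M Mᶜ * block P Mᶜ Mᶜ ^ t * block P Mᶜ M * block P M Mᶜ := by
  have h1 : block P M M ^ r * block P M Mᶜ = s ^ r • block P M Mᶜ := by
    rw [h.block_compl, Matrix.mul_smul, h.block_pow_mul, smul_comm]
  rw [Matrix.mul_assoc _ (block P M M ^ r), h1]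
  simp only [Matrix.mul_smul, Matrix.smul_mul]

theorem comm_right (h : IsPhaseType P M q s) :
    Commute (block P Mᶜ Mᶜ) (block P Mᶜ M * block P M Mᶜ) := by
  rw [h.block_compl_compl]
  exact (Commute.one_left _).smul_left q

/-- Invertibility of `1 - P_M` excludes the eigenvalue `1`, as the all-ones matrix is not empty. -/
theorem one_sub_ne_zero (h : IsPhaseType P M q s) (hM : M.Nonempty)
    (hMc : (Mᶜ : Finset S).Nonempty) (hinv : IsUnit (1 - block P M M)) : 1 - s ≠ 0 := by
  intro hs
  have hdet : IsUnit (1 - block P M M).det := (Matrix.isUnit_iff_isUnit_det _).1 hinv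
  have h1 : (1 - block P M M) * (Matrix.of fun _ _ => 1 : Matrix M (Mᶜ : Finset S) ℝ) = 0 := by
    rw [Matrix.sub_mul, Matrix.one_mul, h.block_mul, ← one_smul ℝ (Matrix.of fun _ _ => (1 : ℝ)),
      smul_smul, mul_one, ← sub_smul, hs, zero_smul]
  have h2 := Matrix.nonsing_inv_mul_cancel_left _
    (Matrix.of fun _ _ => 1 : Matrix M (Mᶜ : Finset S) ℝ) hdet
  rw [h1, Matrix.mul_zero] at h2
  obtain ⟨i, hi⟩ := hM
  obtain ⟨j, hj⟩ := hMc
  have h3 := congrFun (congrFun h2 ⟨i, hi⟩) ⟨j, hj⟩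
  simp at h3

theorem inv_pow_mul (h : IsPhaseType P M q s) (hs : 1 - s ≠ 0)
    (hinv : IsUnit (1 - block P M M)) (n : ℕ) :
    (1 - block P M M)⁻¹ ^ n * (Matrix.of fun _ _ => 1 : Matrix M (Mᶜ : Finset S) ℝ)
      = (1 - s)⁻¹ ^ n • Matrix.of fun _ _ => 1 := by
  have hdet : IsUnit (1 - block P M M).det := (Matrix.isUnit_iff_isUnit_det _).1 hinv
  have h1 : (1 - block P M M) * (Matrix.of fun _ _ => 1 : Matrix M (Mᶜ : Finset S) ℝ)
      = (1 - s) • Matrix.of fun _ _ => 1 := by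
    rw [Matrix.sub_mul, Matrix.one_mul, h.block_mul, sub_smul, one_smul]
  have h2 : (1 - block P M M)⁻¹ * (Matrix.of fun _ _ => 1 : Matrix M (Mᶜ : Finset S) ℝ)
      = (1 - s)⁻¹ • Matrix.of fun _ _ => 1 := by
    have h3 := Matrix.nonsing_inv_mul_cancel_left _
      (Matrix.of fun _ _ => 1 : Matrix M (Mᶜ : Finset S) ℝ) hdet
    rw [h1, Matrix.mul_smul] at h3
    rw [← h3, smul_smul, inv_mul_cancel₀ hs, one_smul, h3]
  induction n with
  | zero => simp
  | succ n ih => rw [pow_succ, Matrix.mul_assoc, h2, Matrix.mul_smul, ih, smul_smul, ← pow_succ']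

/-- The summands of the moment formula reduce to scalar multiples of the all-ones matrix. -/
theorem moment_term (h : IsPhaseType P M q s) (hs : 1 - s ≠ 0)
    (hinv : IsUnit (1 - block P M M)) (j r u : ℕ) :
    block P M M ^ j * (1 - block P M M)⁻¹ ^ (j + r + 1) * block P M Mᶜ * block P Mᶜ Mᶜ ^ u *
        (block P Mᶜ M * block P M Mᶜ) ^ r
      = ((1 - q) ^ r * q ^ u * (s / (1 - s)) ^ j) • Matrix.of fun _ _ => 1 := by
  rw [h.excursion, h.block_compl, h.block_compl_compl]
  simp only [smul_pow, one_pow, Matrix.mul_smul, Matrix.mul_one, Matrix.mul_assoc,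
    h.inv_pow_mul hs hinv, h.block_pow_mul, smul_smul]
  congr 1
  rw [mul_pow (1 - s), div_pow, inv_pow]
  field_simp
  ring

end IsPhaseType

end PhaseType

namespace IsPhaseType

variable {S Ω : Type*} [Fintype S] [DecidableEq S] [MeasurableSpace S]
  [DiscreteMeasurableSpace S] [MeasurableSpace Ω] {P : Matrix S S ℝ} {ℙ : S → Measure Ω}
  {X : ℕ → Ω → S} {M : Finset S} {p q s : ℝ}

theorem hasPassageMoment (h : IsPhaseType P M q s) (hP : P ∈ Matrix.rowStochastic ℝ S)
    (hX : IsMarkovFamily P ℙ X) (hs : 1 - s ≠ 0) (hinv : IsUnit (1 - block P M M))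
    (m : ℕ) {k : ℕ} (hk : 1 ≤ k) :
    HasPassageMoment ℙ X M k m
      ((∑ r ∈ range k, ((k - 1).choose r : ℝ) * ((1 - q) ^ r * q ^ (k - 1 - r)) *
        ∑ j ∈ range (m + 1), msn m j ((k : ℝ) + r) * ((j + r).choose j : ℝ) *
          (s / (1 - s)) ^ j) • Matrix.of (fun _ _ => 1)) := by
  convert hasPassageMoment_of_comm hP hX hinv h.comm_left h.comm_right m hk using 1
  simp only [h.moment_term hs hinv, smul_sum, smul_smul, sum_smul, mul_sum]
  refine sum_congr rfl fun r _ => sum_congr rfl fun j _ => ?_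
  congr 1
  ring

/-- If every step enters the complement of `M` with probability `p`, all `r` contribute the same
power `p ^ k * (1 - p) ^ (n - k)` to the closed form of the distribution, and Vandermonde's identity
sums the binomial coefficients. -/
theorem passageProb_eq_negBinomial (h : IsPhaseType P M p (1 - p)) (hX : IsMarkovFamily P ℙ X)
    {k : ℕ} (hk : 1 ≤ k) (n : ℕ) :
    passageProb ℙ X M k n = Matrix.of fun _ _ => negBinomial p k n := by
  rw [negBinomial]
  split_ifs with hkn
  · obtain ⟨k, rfl⟩ : ∃ k', k = k' + 1 := ⟨k - 1, by omega⟩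
    obtain ⟨l, rfl⟩ := Nat.exists_eq_add_of_le hkn
    have hvan : ((k + l).choose k : ℝ)
        = ∑ r ∈ range (k + 1), (k.choose r : ℝ) * (l.choose r : ℝ) := by
      rw [add_comm k l, Nat.add_choose_eq, Finset.Nat.sum_antidiagonal_eq_sum_range_succ_mk]
      push_cast
      refine sum_congr rfl fun r hr => ?_
      rw [Nat.choose_symm (Nat.lt_succ_iff.1 (mem_range.1 hr)), mul_comm]
    have hterm : ∀ r ∈ range (k + 1), ((k.choose r : ℝ) * (l.choose r : ℝ)) •
        (block P M M ^ (l - r) * block P M Mᶜ * block P Mᶜ Mᶜ ^ (k - r) *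
          (block P Mᶜ M * block P M Mᶜ) ^ r)
        = ((k.choose r : ℝ) * (l.choose r : ℝ) * (p ^ (k + 1) * (1 - p) ^ l)) •
          (Matrix.of fun _ _ => 1 : Matrix M (Mᶜ : Finset S) ℝ) := by
      intro r hr
      rcases lt_or_ge l r with hlr | hlr
      · rw [Nat.choose_eq_zero_of_lt hlr]; simp
      · rw [h.excursion, h.block_compl, h.block_compl_compl]
        simp only [smul_pow, one_pow, Matrix.mul_smul, Matrix.mul_one,
          h.block_pow_mul, smul_smul]
        congr 1
        obtain ⟨u, rfl⟩ := Nat.exists_eq_add_of_le hlr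
        obtain ⟨v, rfl⟩ := Nat.exists_eq_add_of_le (Nat.lt_succ_iff.1 (mem_range.1 hr))
        rw [Nat.add_sub_cancel_left, Nat.add_sub_cancel_left, sub_sub_cancel, mul_pow]
        ring
    rw [passageProb_succ_add hX h.comm_left h.comm_right, sum_congr rfl hterm, ← sum_smul,
      ← sum_mul, ← hvan, show k + 1 + l - 1 = k + l by omega, Nat.add_sub_cancel_left,
      Nat.add_sub_cancel]
    ext i j
    simp [mul_assoc]
  · rw [passageProb_eq_zero_of_lt hX (not_le.1 hkn)]
    rfl

/-- In the negative binomial case a single moment series, with `r = k - 1`, gives the moments. -/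
theorem hasPassageMoment_negBinomial (h : IsPhaseType P M p (1 - p)) (hp : p ≠ 0)
    (hP : P ∈ Matrix.rowStochastic ℝ S) (hX : IsMarkovFamily P ℙ X)
    (hinv : IsUnit (1 - block P M M)) (m : ℕ) {k : ℕ} (hk : 1 ≤ k) :
    HasPassageMoment ℙ X M k m
      (Matrix.of fun _ _ => ∑ j ∈ range (m + 1),
        ((j + k - 1).choose (k - 1) : ℝ) * msn m j k * ((1 - p) / p) ^ j) := by
  rw [hasPassageMoment_iff hX]
  have h1 := (hasSum_matrix_mul (hasSum_moment_of_substochastic (block_nonneg hP M M)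
    (sum_block_le_one hP) hinv k m (k - 1))
    (Matrix.of fun _ _ => 1 : Matrix M (Mᶜ : Finset S) ℝ)).const_smul (p ^ k)
  have hp' : 1 - (1 - p) ≠ 0 := by rwa [sub_sub_cancel]
  simp only [Matrix.sum_mul, Matrix.smul_mul, Matrix.mul_assoc, h.inv_pow_mul hp' hinv,
    Matrix.mul_smul, h.block_pow_mul, smul_sum, smul_smul] at h1
  convert h1 using 1
  · funext l
    rw [h.passageProb_eq_negBinomial hX hk, negBinomial, if_pos (Nat.le_add_right k l),
      Nat.add_sub_cancel_left, show l + (k - 1) = k + l - 1 by omega]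
    ext i j
    simp only [Matrix.smul_apply, Matrix.of_apply, smul_eq_mul]
    ring
  · ext i i'
    simp only [Matrix.sum_apply, Matrix.smul_apply, Matrix.of_apply, smul_eq_mul, mul_one]
    refine sum_congr rfl fun j _ => ?_
    rw [sub_sub_cancel, Nat.choose_symm_add, show j + (k - 1) = j + k - 1 by omega,
      show j + k - 1 + 1 = j + k by omega, div_pow, inv_pow, pow_add]
    field_simp

end IsPhaseType

/-- For `q ≠ 0` the factor `(1 - q) ^ r * q ^ (k - 1 - r)` may be written with a quotient. -/
theorem sum_div_pow_mul_pow {q : ℝ} (hq : q ≠ 0) (k : ℕ) (f g : ℕ → ℝ) :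
    ∑ r ∈ range k, f r * ((1 - q) / q) ^ r * q ^ (k - 1) * g r
      = ∑ r ∈ range k, f r * ((1 - q) ^ r * q ^ (k - 1 - r)) * g r := by
  refine sum_congr rfl fun r hr => ?_
  have hr' : k - 1 = r + (k - 1 - r) := by have := mem_range.1 hr; omega
  rw [div_pow, show q ^ (k - 1) = q ^ r * q ^ (k - 1 - r) by rw [← pow_add, ← hr']]
  field_simp

theorem mulVec_one_of_card_eq_one {S : Type*} {P : Matrix S S ℝ} {M : Finset S} {s : ℝ}
    (hcard : #M = 1) (hs : block P M M = Matrix.of fun _ _ => s) :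
    Matrix.mulVec (block P M M) (fun _ => 1) = s • (fun _ => 1) := by
  ext i
  simp [hs, Matrix.mulVec, dotProduct, hcard]

theorem mainTheorem3 {S Ω : Type*} [Fintype S] [DecidableEq S] [MeasurableSpace S]
    [DiscreteMeasurableSpace S] [MeasurableSpace Ω]
    (P : Matrix S S ℝ) (hP : P ∈ Matrix.rowStochastic ℝ S)
    (ℙ : S → Measure Ω) (X : ℕ → Ω → S) (hX : IsMarkovFamily P ℙ X)
    (M : Finset S) (hM : M.Nonempty) (hMc : (Mᶜ : Finset S).Nonempty)
    (hinv : IsUnit (1 - block P M M))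
    (m k : ℕ) (hk : 1 ≤ k) :
    -- a)
    (IsCommutable P M Mᶜ → IsCommutable P Mᶜ M →
      HasPassageMoment ℙ X M k m
        (∑ r ∈ range k, ((k - 1).choose r : ℝ) • ∑ j ∈ range (m + 1),
          (msn m j ((k : ℝ) + r) * ((j + r).choose j : ℝ)) •
            (block P M M ^ j * (1 - block P M M)⁻¹ ^ (j + r + 1) * block P M Mᶜ *
              block P Mᶜ Mᶜ ^ (k - 1 - r) * (block P Mᶜ M * block P M Mᶜ) ^ r))) ∧
    -- b)
    (∀ q s : ℝ, #(Mᶜ) = 1 → block P Mᶜ Mᶜ = Matrix.of (fun _ _ => q) →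
      Matrix.mulVec (block P M M) (fun _ => 1) = s • (fun _ => 1) →
      HasPassageMoment ℙ X M k m
        ((∑ r ∈ range k, ((k - 1).choose r : ℝ) * ((1 - q) ^ r * q ^ (k - 1 - r)) *
          ∑ j ∈ range (m + 1), msn m j ((k : ℝ) + r) * ((j + r).choose j : ℝ) *
            (s / (1 - s)) ^ j) • Matrix.of (fun _ _ => 1)) ∧
      (q ≠ 0 → HasPassageMoment ℙ X M k m
        ((∑ r ∈ range k, ((k - 1).choose r : ℝ) * ((1 - q) / q) ^ r * q ^ (k - 1) *
          ∑ j ∈ range (m + 1), msn m j ((k : ℝ) + r) * ((j + r).choose j : ℝ) *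
            (s / (1 - s)) ^ j) • Matrix.of (fun _ _ => 1)))) ∧
    -- c)
    (∀ p q : ℝ, #(Mᶜ) = 1 → #M = 1 → block P Mᶜ Mᶜ = Matrix.of (fun _ _ => q) →
      block P M M = Matrix.of (fun _ _ => 1 - p) →
      HasPassageMoment ℙ X M k m
        (Matrix.of fun _ _ =>
          ∑ r ∈ range k, ((k - 1).choose r : ℝ) * ((1 - q) ^ r * q ^ (k - 1 - r)) *
            ∑ j ∈ range (m + 1), msn m j ((k : ℝ) + r) * ((j + r).choose j : ℝ) *
              ((1 - p) / p) ^ j) ∧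
      (q ≠ 0 → HasPassageMoment ℙ X M k m
        (Matrix.of fun _ _ =>
          ∑ r ∈ range k, ((k - 1).choose r : ℝ) * ((1 - q) / q) ^ r * q ^ (k - 1) *
            ∑ j ∈ range (m + 1), msn m j ((k : ℝ) + r) * ((j + r).choose j : ℝ) *
              ((1 - p) / p) ^ j))) ∧
    -- d)
    (∀ p : ℝ, #(Mᶜ) = 1 → #M = 1 → block P Mᶜ Mᶜ = Matrix.of (fun _ _ => p) →
      block P M M = Matrix.of (fun _ _ => 1 - p) →
      (∀ n : ℕ, passageProb ℙ X M k n = Matrix.of (fun _ _ => negBinomial p k n)) ∧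
      HasPassageMoment ℙ X M k m
        (Matrix.of fun _ _ =>
          ∑ j ∈ range (m + 1), ((j + k - 1).choose (k - 1) : ℝ) * msn m j k *
            ((1 - p) / p) ^ j)) := by
  refine ⟨fun hA hC => ?_, fun q s hcard hq hs => ?_, fun p q hcard hcard' hq hp => ?_,
    fun p hcard hcard' hq hp => ?_⟩
  · refine hasPassageMoment_of_comm hP hX hinv (fun r t => ?_) ?_ m hk
    · rw [hA r t]
    · have := hC 1 0
      simp only [pow_zero, pow_one, Matrix.mul_one] at this
      exact (this.trans (Matrix.mul_assoc _ _ _)).symm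
  · have h := isPhaseType_of_card_eq_one hP hcard hq hs
    have h1 := h.hasPassageMoment hP hX (h.one_sub_ne_zero hM hMc hinv) hinv m hk
    refine ⟨h1, fun hq0 => ?_⟩
    rw [sum_div_pow_mul_pow hq0]
    exact h1
  · have h := isPhaseType_of_card_eq_one hP hcard hq (mulVec_one_of_card_eq_one hcard' hp)
    have h1 := h.hasPassageMoment hP hX (h.one_sub_ne_zero hM hMc hinv) hinv m hk
    rw [sub_sub_cancel, Matrix.smul_of] at h1
    simp only [Pi.smul_def, smul_eq_mul, mul_one] at h1
    refine ⟨h1, fun hq0 => ?_⟩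
    simp only [sum_div_pow_mul_pow hq0]
    exact h1
  · have h := isPhaseType_of_card_eq_one hP hcard hq (mulVec_one_of_card_eq_one hcard' hp)
    have hp0 := h.one_sub_ne_zero hM hMc hinv
    rw [sub_sub_cancel] at hp0
    exact ⟨h.passageProb_eq_negBinomial hX hk, h.hasPassageMoment_negBinomial hp0 hP hX hinv m hk⟩
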